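/- **Theorem 1 (real vector search problem: quantum lower bound).** In the real vector search problem one is given $C\ge 2$ independent random vectors $x_1,\dots,x_C\in\mathbb C^{2^n}$; one of them, $x_{k^*}$, with $k^*$ uniform in $\{1,\dots,C\}$, is uniform on the real unit sphere $\{x\in\mathbb R^{2^n}:\|x\|_2=1\}$, and the others are uniform on the complex unit sphere $\{x\in\mathbb C^{2^n}:\|x\|_2=1\}$. The task is to output $k^*$. A quantum algorithm starts with an empty register; in each step it either adjoins to its register a fresh copy of one of the states $|x_i\rangle$ or performs an arbitrary quantum operation (given by finitely many Kraus operators $K_j$ with $\sum_j K_j^\dagger K_j=1$) on its register, and its later steps may depend on the classical outcomes $j$; finally it stops and outputs an index. Each step has unit cost; the running time, and the number of copies of $|x_i\rangle$ used, are taken in the worst case over the measurement outcomes. 1. There is a constant $c>0$ such that for all $C\ge 2$ and $n\ge 0$, every quantum algorithm that outputs $k^*$ with probability at least $0.9$ (over $k^*$, the vectors, and the measurements) uses at least $c\,2^{n/2}$ copies of one of the states $|x_i\rangle$, and has running time at least $c\,2^{n/2}$. (In particular this holds for an algorithm that succeeds with probability at least $0.9$ for every fixed value of $k^*$.) 2.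 For all $n,N\ge 0$, with $d=2^n$, $$\Bigl\|\,\mathbb E_{\psi}\,(|\psi\rangle\langle\psi|)^{\otimes N}-\mathbb E_{\phi}\,(|\phi\rangle\langle\phi|)^{\otimes N}\Bigr\|_1\le \frac{4N^2}{d},$$ where $\psi$ is uniform on the complex unit sphere of $\mathbb C^d$, $\phi$ is uniform on the real unit sphere of $\mathbb R^d\subset\mathbb C^d$, and $\|\cdot\|_1$ is the trace norm. -/

import Mathlib

open MeasureTheory
open scoped Matrix

noncomputable section

namespace RealVectorSearch

/-- The uniform probability measure on the unit sphere of a finite-dimensional real normed space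
(here always Euclidean): the normalized surface measure. -/
def uniformSphere (E : Type*) [NormedAddCommGroup E] [NormedSpace ℝ E] [FiniteDimensional ℝ E]
    [MeasurableSpace E] [BorelSpace E] : Measure (Metric.sphere (0 : E) 1) :=
  ((Measure.addHaar : Measure E).toSphere Set.univ)⁻¹ • (Measure.addHaar : Measure E).toSphere

/-- The inclusion of `ℝ^d` in `ℂ^d`. -/
def realToComplex {d : ℕ} (x : EuclideanSpace ℝ (Fin d)) : EuclideanSpace ℂ (Fin d) :=
  WithLp.toLp 2 fun a => (x a : ℂ)

/-- The law on `ℂ^d` of a uniformly random vector of the real unit sphere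
`{x ∈ ℝ^d : ‖x‖₂ = 1}`. -/
def realHaar (d : ℕ) : Measure (EuclideanSpace ℂ (Fin d)) :=
  (uniformSphere (EuclideanSpace ℝ (Fin d))).map fun x => realToComplex x.1

/-- The law on `ℂ^d` of a uniformly random vector of the complex unit sphere
`{x ∈ ℂ^d : ‖x‖₂ = 1}`. -/
def complexHaar (d : ℕ) : Measure (EuclideanSpace ℂ (Fin d)) :=
  (uniformSphere (EuclideanSpace ℂ (Fin d))).map fun x => x.1

/-- The law of an instance `x_1, …, x_C ∈ ℂ^(2^n)` of the search problem whose real vector has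
index `k`: the vectors are independent, the `k`-th one is uniform on the real unit sphere, and all
other ones are uniform on the complex unit sphere. -/
def instanceLaw (n C : ℕ) (k : Fin C) : Measure (Fin C → EuclideanSpace ℂ (Fin (2 ^ n))) :=
  Measure.pi fun i => if i = k then realHaar (2 ^ n) else complexHaar (2 ^ n)

/-- The state `v ⊗ x`. -/
def adjoin {m d : ℕ} (v : Fin m → ℂ) (x : Fin d → ℂ) : Fin (m * d) → ℂ :=
  fun a => v a.divNat * x a.modNat

/-- A quantum algorithm which has access to copies of `|x_1⟩, …, |x_C⟩`, where
`x_1, …, x_C ∈ ℂ^(2^n)`, and whose quantum register has dimension `m` at present.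
It does one of the following:
* it stops and outputs an index `k`;
* it takes a fresh copy of `|x_i⟩` into its register and goes on;
* it performs an arbitrary quantum operation on its whole register, with Kraus operators
  `K_j` such that `∑ j, K_jᴴ K_j = 1`, and goes on in a way that may depend on the
  classical outcome `j`. Unitary gates (`r = 1`), the introduction of ancillas, discarding
  subsystems, noise, measurements and adaptive control are special cases. -/
inductive QAlg (n C : ℕ) : ℕ → Type
  | output {m : ℕ} (k : Fin C) : QAlg n C m
  | copy {m : ℕ} (i : Fin C) (next : QAlg n C (m * 2 ^ n)) : QAlg n C m
  | operation {m m' r : ℕ} (K : Fin r → Matrix (Fin m') (Fin m) ℂ)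
      (complete : ∑ j, (K j)ᴴ * K j = 1) (next : Fin r → QAlg n C m') : QAlg n C m

namespace QAlg

variable {n C : ℕ}

/-- The probability that the algorithm outputs `k` on the input `x_1, …, x_C`, when it is run from
the register state `v`. The state is kept unnormalized (its squared norm is the probability of the
classical outcomes so far), so that the outcome `j` of an operation takes `v` to `K_j v`. -/
def outputProb (x : Fin C → EuclideanSpace ℂ (Fin (2 ^ n))) (k : Fin C) :
    {m : ℕ} → QAlg n C m → (Fin m → ℂ) → ℝ
  | _, output k', v => if k' = k then ∑ a, ‖v a‖ ^ 2 else 0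
  | _, copy i next, v => outputProb x k next (adjoin v fun a => x i a)
  | _, operation K _ next, v => ∑ j, outputProb x k (next j) (K j *ᵥ v)

/-- The number of copies of `|x_i⟩` that the algorithm uses (in the worst case over the
measurement outcomes). -/
def copies (i : Fin C) : {m : ℕ} → QAlg n C m → ℕ
  | _, output _ => 0
  | _, copy i' next => (if i' = i then 1 else 0) + copies i next
  | _, operation _ _ next => Finset.univ.sup fun j => copies i (next j)

/-- The running time of the algorithm (in the worst case over the measurement outcomes), where the
preparation of one copy of a state has unit cost, and so has any one quantum operation. -/
def time : {m : ℕ} → QAlg n C m → ℕ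
  | _, output _ => 0
  | _, copy _ next => 1 + time next
  | _, operation _ _ next => 1 + Finset.univ.sup fun j => time (next j)

/-- The probability that the algorithm, started with a one-dimensional (that is, empty) register,
finds the index of the real vector, over the uniformly random position `k` of this vector, the
random vectors, and the randomness of the algorithm. -/
def successProb (A : QAlg n C 1) : ℝ :=
  (C : ℝ)⁻¹ * ∑ k, ∫ x, outputProb x k A (fun _ => 1) ∂(instanceLaw n C k)

end QAlg

/-- The `N`-copy moment `E (|ψ⟩⟨ψ|)^{⊗N}` of a random vector `ψ ∈ ℂ^d` of law `μ`, as a matrix on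
`(ℂ^d)^{⊗N}`. -/
def moment {d : ℕ} (N : ℕ) (μ : Measure (EuclideanSpace ℂ (Fin d))) :
    Matrix (Fin N → Fin d) (Fin N → Fin d) ℂ :=
  Matrix.of fun a b => ∫ ψ, ∏ i, (ψ (a i) * star (ψ (b i))) ∂μ

/-- The trace norm `‖A‖₁`: the sum of the singular values of `A`. -/
def traceNorm {ι : Type*} [Fintype ι] [DecidableEq ι] (A : Matrix ι ι ℂ) : ℝ :=
  ∑ i ∈ Finset.range (Fintype.card ι), (Matrix.toEuclideanLin A).singularValues i

end RealVectorSearch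

end

open MeasureTheory
open scoped Matrix

noncomputable section

namespace RealVectorSearch

/-! Everything rests on one comparison: for `f` homogeneous of degree `s` on `ℂ^d`, the mean of
`|f|²` over the real sphere is at least `α_s = ∏_{i<s} (d+i)/(d+2i)` times its mean over the complex
sphere (`haarRatio_mul_integral_normSq_eval_le`). Polar coordinates turn both means into Gaussian
ones. Under the complex Gaussian the monomials are orthogonal, which gives exactly the Fischer norm
`∑ |c_β|² β!`. Under the real Gaussian, replacing each power by a Hermite polynomial projects `f`
orthogonally onto its top Wiener chaos, whose squared norm is again the Fischer norm, so the real
mean can only be larger.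

For part 2, apply this to `x ↦ ⟨w, x^{⊗N}⟩`: the real moment dominates `α_N` times the complex one
as an operator. The difference of the moments is then a difference of two positive operators of
trace `1 - α_N ≤ N²/(2d)`.

For part 1, along every branch of an algorithm the amplitudes are homogeneous polynomials in `x_k`,
of degree the number of copies of `x_k` used so far. Making the real vector complex hence lowers no
output probability by more than the factor `α_N`. On all-complex input the output carries no
information on `k`, so success is at most `1 - α_N/2`, and success `0.9` forces `N² ≥ (8/5) 2^n`. -/

/-! ### Hermite polynomials and the real Gaussian -/

open Polynomial in
theorem integrable_polynomial_mul_gaussian (p : ℝ[X]) :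
    Integrable fun x : ℝ => p.eval x * Real.exp (-x ^ 2 / 2) := by
  induction p using Polynomial.induction_on' with
  | add p q hp hq => exact (hp.add hq).congr (.of_forall fun x => by simp [add_mul])
  | monomial n a =>
    have h := (integrable_rpow_mul_exp_neg_mul_sq (b := 1 / 2) (by norm_num) (s := n)
      (by linarith [(Nat.cast_nonneg n : (0 : ℝ) ≤ n)])).const_mul a
    refine h.congr (.of_forall fun x => ?_)
    simp only [Real.rpow_natCast, eval_monomial]
    ring_nf

open Polynomial in
/-- The Hermite polynomial with real coefficients. -/
def realHermite (n : ℕ) : ℝ[X] := (hermite n).map (Int.castRingHom ℝ)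

open Polynomial in
theorem realHermite_succ (n : ℕ) :
    realHermite (n + 1) = X * realHermite n - derivative (realHermite n) := by
  simp [realHermite, hermite_succ, derivative_map]

open Polynomial in
theorem hasDerivAt_realHermite_mul_gaussian (n : ℕ) (x : ℝ) :
    HasDerivAt (fun x => (realHermite n).eval x * Real.exp (-x ^ 2 / 2))
      (-((realHermite (n + 1)).eval x * Real.exp (-x ^ 2 / 2))) x := by
  have h1 := (realHermite n).hasDerivAt x
  have h2 : HasDerivAt (fun x : ℝ => Real.exp (-x ^ 2 / 2)) (Real.exp (-x ^ 2 / 2) * (-x)) x := by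
    have h3 : HasDerivAt (fun x : ℝ => -x ^ 2 / 2) (-x) x := by
      refine (((hasDerivAt_id' x).fun_pow 2).fun_neg.div_const 2).congr_deriv ?_
      push_cast
      ring
    exact h3.exp
  refine (h1.fun_mul h2).congr_deriv ?_
  rw [realHermite_succ]
  simp only [eval_sub, eval_mul, eval_X]
  ring

-- Integration by parts: each Hermite index is traded for one derivative of `p`.
open Polynomial in
theorem integral_mul_realHermite_succ (p : ℝ[X]) (n : ℕ) :
    ∫ x : ℝ, p.eval x * (realHermite (n + 1)).eval x * Real.exp (-x ^ 2 / 2) =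
      ∫ x : ℝ, p.derivative.eval x * (realHermite n).eval x * Real.exp (-x ^ 2 / 2) := by
  have h := integral_mul_deriv_eq_deriv_mul_of_integrable (u := fun x => p.eval x)
    (v := fun x => (realHermite n).eval x * Real.exp (-x ^ 2 / 2))
    (fun x _ => p.hasDerivAt x) (fun x _ => hasDerivAt_realHermite_mul_gaussian n x)
    (((integrable_polynomial_mul_gaussian (p * realHermite (n + 1))).neg).congr
      (.of_forall fun x => by simp; ring))
    ((integrable_polynomial_mul_gaussian (p.derivative * realHermite n)).congr
      (.of_forall fun x => by simp; ring))
    ((integrable_polynomial_mul_gaussian (p * realHermite n)).congr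
      (.of_forall fun x => by simp; ring))
  simp only [mul_neg, integral_neg, neg_inj] at h
  simpa only [mul_assoc] using h

open Polynomial in
theorem integral_mul_realHermite (p : ℝ[X]) (n : ℕ) :
    ∫ x : ℝ, p.eval x * (realHermite n).eval x * Real.exp (-x ^ 2 / 2) =
      ∫ x : ℝ, (derivative^[n] p).eval x * Real.exp (-x ^ 2 / 2) := by
  induction n generalizing p with
  | zero => simp [realHermite]
  | succ n ih => rw [integral_mul_realHermite_succ, ih]; rfl

-- After `n` integrations by parts only the constant `n! * p.coeff n` is left. This covers both
-- orthogonality to lower degrees and the pairing with monic polynomials of degree `n`.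
open Polynomial in
theorem integral_mul_realHermite_of_natDegree_le {p : ℝ[X]} {n : ℕ} (hp : p.natDegree ≤ n) :
    ∫ x : ℝ, p.eval x * (realHermite n).eval x * Real.exp (-x ^ 2 / 2) =
      n.factorial * p.coeff n * ∫ x : ℝ, Real.exp (-x ^ 2 / 2) := by
  have h : derivative^[n] p = C (n.factorial * p.coeff n) := by
    ext k
    rw [coeff_iterate_derivative, coeff_C]
    split_ifs with hk
    · simp [hk, Nat.descFactorial_self]
    · rw [coeff_eq_zero_of_natDegree_lt (by omega), smul_zero]
  rw [integral_mul_realHermite, h]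
  simp [integral_const_mul]

theorem natDegree_realHermite (n : ℕ) : (realHermite n).natDegree = n := by
  rw [realHermite, (Polynomial.hermite_monic n).natDegree_map, Polynomial.natDegree_hermite]

theorem coeff_realHermite_self (n : ℕ) : (realHermite n).coeff n = 1 := by
  simp [realHermite]

/-! ### Moments of the complex Gaussian -/

theorem integrable_norm_pow_mul_exp_neg_sq (k : ℕ) :
    Integrable fun z : ℂ => ‖z‖ ^ k * Real.exp (-‖z‖ ^ 2) := by
  have h := Complex.integral_rpow_mul_exp_neg_rpow (p := 2) (q := k) (by norm_num)
    (by linarith [(Nat.cast_nonneg k : (0 : ℝ) ≤ k)])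
  simp only [Real.rpow_natCast, Real.rpow_ofNat] at h
  -- A non-integrable function has integral `0` by convention, but the closed form in `h` is
  -- positive.
  by_contra hi
  rw [integral_undef hi] at h
  have : 0 < Real.Gamma (((k : ℝ) + 2) / 2) := Real.Gamma_pos_of_pos (by positivity)
  have := Real.pi_pos
  exact absurd h.symm (by positivity)

theorem integrable_monomial_mul_complexGaussian (m n : ℕ) :
    Integrable fun z : ℂ => z ^ m * star (z ^ n) * (Real.exp (-‖z‖ ^ 2) : ℂ) := by
  refine (integrable_norm_pow_mul_exp_neg_sq (m + n)).mono' (by fun_prop)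
    (.of_forall fun z => le_of_eq ?_)
  rw [norm_mul, norm_mul, norm_star, norm_pow, norm_pow, Complex.norm_real, Real.norm_eq_abs,
    abs_of_pos (Real.exp_pos _), pow_add]

theorem integral_monomial_mul_complexGaussian_of_ne {m n : ℕ} (h : m ≠ n) :
    ∫ z : ℂ, z ^ m * star (z ^ n) * (Real.exp (-‖z‖ ^ 2) : ℂ) = 0 := by
  have hmn : (m : ℝ) - n ≠ 0 := sub_ne_zero.2 (by exact_mod_cast h)
  -- The angle is chosen so that rotation by `u` multiplies the integrand by `e^{iπ} = -1`.
  set u : Circle := Circle.exp (Real.pi / (m - n)) with hu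
  have hinv := (rotation u).measurePreserving.integral_comp
    (rotation u).toHomeomorph.measurableEmbedding
    (fun z : ℂ => z ^ m * star (z ^ n) * (Real.exp (-‖z‖ ^ 2) : ℂ))
  have hu1 : (u : ℂ) ^ m * star ((u : ℂ) ^ n) = -1 := by
    rw [hu, Circle.coe_exp, ← Complex.exp_nat_mul, ← Complex.exp_nat_mul, Complex.star_def,
      ← Complex.exp_conj, ← Complex.exp_add, ← Complex.exp_pi_mul_I]
    congr 1
    have : ((m : ℂ) - n) ≠ 0 := by exact_mod_cast hmn
    simp only [map_mul, Complex.conj_ofReal, Complex.conj_I, Complex.conj_natCast]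
    push_cast
    field_simp
    ring
  have hfun : ∀ z : ℂ, (rotation u z) ^ m * star ((rotation u z) ^ n) *
      (Real.exp (-‖rotation u z‖ ^ 2) : ℂ) =
        -(z ^ m * star (z ^ n) * (Real.exp (-‖z‖ ^ 2) : ℂ)) := by
    intro z
    rw [LinearIsometryEquiv.norm_map, rotation_apply, mul_pow, mul_pow, star_mul]
    linear_combination (z ^ m * star (z ^ n) * (Real.exp (-‖z‖ ^ 2) : ℂ)) * hu1
  simp only [hfun, integral_neg] at hinv
  exact self_eq_neg.1 hinv.symm

theorem integral_monomial_mul_complexGaussian_self (n : ℕ) :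
    ∫ z : ℂ, z ^ n * star (z ^ n) * (Real.exp (-‖z‖ ^ 2) : ℂ) = n.factorial * (Real.pi : ℂ) := by
  have h := Complex.integral_rpow_mul_exp_neg_rpow (p := 2) (q := (2 * n : ℕ)) (by norm_num)
    (by linarith [(Nat.cast_nonneg (2 * n) : (0 : ℝ) ≤ (2 * n : ℕ))])
  simp only [Real.rpow_natCast, Real.rpow_ofNat] at h
  have e : ∀ z : ℂ, z ^ n * star (z ^ n) * (Real.exp (-‖z‖ ^ 2) : ℂ) =
      ((‖z‖ ^ (2 * n) * Real.exp (-‖z‖ ^ 2) : ℝ) : ℂ) := by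
    intro z
    rw [Complex.star_def, Complex.mul_conj, Complex.normSq_eq_norm_sq, norm_pow]
    push_cast
    ring
  simp only [e]
  rw [integral_complex_ofReal, h]
  have : (((2 * n : ℕ) : ℝ) + 2) / 2 = n + 1 := by push_cast; ring
  rw [this, Real.Gamma_nat_eq_factorial]
  push_cast
  ring

/-- The polynomial `f`, with the powers `x_i ^ m` in its monomials replaced by `P m (x_i)`. -/
def substPowers {ι X : Type*} [Fintype ι] (P : ℕ → X → ℂ) (f : MvPolynomial ι ℂ) (x : ι → X) : ℂ :=
  ∑ β ∈ f.support, f.coeff β * ∏ i, P (β i) (x i)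

theorem substPowers_pow {ι X : Type*} [Fintype ι] (φ : X → ℂ) (f : MvPolynomial ι ℂ) (x : ι → X) :
    substPowers (fun m t => φ t ^ m) f x = MvPolynomial.eval (fun i => φ (x i)) f := by
  rw [MvPolynomial.eval_eq', substPowers]

/-- The squared Fischer norm `∑ |c_β|² β!` of a polynomial. -/
def fischerNormSq {ι : Type*} [Fintype ι] (f : MvPolynomial ι ℂ) : ℝ :=
  ∑ β ∈ f.support, ‖f.coeff β‖ ^ 2 * ∏ i, ((β i).factorial : ℝ)

/-! ### Biorthogonal families in several variables -/

section Orthogonality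

variable {ι X : Type*} [Fintype ι] {G H : ℕ → X → ℂ} {w : X → ℝ}

theorem substPowers_mul_star (f : MvPolynomial ι ℂ) (x : ι → X) :
    substPowers G f x * star (substPowers H f x) * ∏ i, (w (x i) : ℂ) =
      ∑ β ∈ f.support, ∑ γ ∈ f.support, f.coeff β * star (f.coeff γ) *
        ∏ i, (G (β i) (x i) * star (H (γ i) (x i)) * (w (x i) : ℂ)) := by
  rw [substPowers, substPowers, star_sum, Finset.sum_mul_sum, Finset.sum_mul]
  refine Finset.sum_congr rfl fun β _ => ?_
  rw [Finset.sum_mul]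
  refine Finset.sum_congr rfl fun γ _ => ?_
  rw [star_mul', star_prod, Finset.prod_mul_distrib, Finset.prod_mul_distrib]
  ring

variable [MeasurableSpace X] {μ : Measure X} [SigmaFinite μ]

theorem integrable_substPowers_mul_star
    (hint : ∀ m n, Integrable (fun x => G m x * star (H n x) * (w x : ℂ)) μ)
    (f : MvPolynomial ι ℂ) :
    Integrable (fun x : ι → X => substPowers G f x * star (substPowers H f x) * ∏ i, (w (x i) : ℂ))
      (Measure.pi fun _ => μ) := by
  simp only [substPowers_mul_star]
  refine integrable_finsetSum _ fun β _ => integrable_finsetSum _ fun γ _ =>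
    Integrable.const_mul ?_ _
  exact Integrable.fintype_prod (f := fun i x => G (β i) x * star (H (γ i) x) * (w x : ℂ))
    fun i => hint _ _

/-- By Fubini each pair of monomials gives a product of one-variable integrals. Vanishing for `m <
n` suffices, because two distinct exponents of equal total degree satisfy `β i < γ i` for some `i`.
This one-sided form is what the pairing of powers with Hermite polynomials needs. -/
theorem integral_substPowers_mul_star
    (hint : ∀ m n, Integrable (fun x => G m x * star (H n x) * (w x : ℂ)) μ) {Z : ℝ}
    (hlt : ∀ m n, m < n → ∫ x, G m x * star (H n x) * (w x : ℂ) ∂μ = 0)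
    (heq : ∀ n, ∫ x, G n x * star (H n x) * (w x : ℂ) ∂μ = n.factorial * (Z : ℂ))
    {f : MvPolynomial ι ℂ} {s : ℕ} (hf : f.IsHomogeneous s) :
    ∫ x : ι → X, substPowers G f x * star (substPowers H f x) * ∏ i, (w (x i) : ℂ)
      ∂(Measure.pi fun _ => μ) = ((Z ^ Fintype.card ι * fischerNormSq f : ℝ) : ℂ) := by
  simp only [substPowers_mul_star]
  have hI : ∀ β γ : ι →₀ ℕ, Integrable (fun x : ι → X => f.coeff β * star (f.coeff γ) *
      ∏ i, (G (β i) (x i) * star (H (γ i) (x i)) * (w (x i) : ℂ))) (Measure.pi fun _ => μ) :=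
    fun β γ => Integrable.const_mul (Integrable.fintype_prod
      (f := fun i x => G (β i) x * star (H (γ i) x) * (w x : ℂ)) fun i => hint _ _) _
  rw [integral_finsetSum _ fun β _ => integrable_finsetSum _ fun γ _ => hI β γ, fischerNormSq,
    Finset.mul_sum, Complex.ofReal_sum]
  refine Finset.sum_congr rfl fun β hβ => ?_
  rw [integral_finsetSum _ fun γ _ => hI β γ, Finset.sum_eq_single_of_mem β hβ]
  · rw [integral_const_mul, integral_fintype_prod_eq_prod
      (f := fun i x => G (β i) x * star (H (β i) x) * (w x : ℂ))]
    simp only [heq, Finset.prod_mul_distrib, Finset.prod_const, Finset.card_univ]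
    rw [Complex.star_def, Complex.mul_conj, Complex.normSq_eq_norm_sq]
    push_cast
    ring
  · intro γ hγ hne
    rw [integral_const_mul, integral_fintype_prod_eq_prod
      (f := fun i x => G (β i) x * star (H (γ i) x) * (w x : ℂ))]
    have hdeg : ∀ δ ∈ f.support, ∑ i, δ i = s := fun δ hδ => by
      have := hf (MvPolynomial.mem_support_iff.1 hδ)
      rw [Finsupp.weight_apply, Finsupp.sum_fintype _ _ (by simp)] at this
      simpa using this
    obtain ⟨i, hi⟩ : ∃ i, β i < γ i := by
      by_contra! hle
      refine hne (Finsupp.ext fun i => ?_)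
      have := (Finset.sum_eq_sum_iff_of_le fun i _ => hle i).1
        ((hdeg γ hγ).trans (hdeg β hβ).symm)
      exact this i (Finset.mem_univ i)
    rw [Finset.prod_eq_zero (Finset.mem_univ i) (hlt _ _ hi), mul_zero]

end Orthogonality

/-! ### Gaussian means of homogeneous polynomials -/

theorem integral_complexGaussian_normSq_eval {ι : Type*} [Fintype ι] {f : MvPolynomial ι ℂ} {s : ℕ}
    (hf : f.IsHomogeneous s) :
    ∫ z : ι → ℂ, ‖MvPolynomial.eval z f‖ ^ 2 * ∏ i, Real.exp (-‖z i‖ ^ 2) =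
      Real.pi ^ Fintype.card ι * fischerNormSq f := by
  have h := integral_substPowers_mul_star (μ := volume) (G := fun n (z : ℂ) => z ^ n)
    (H := fun n z => z ^ n) (w := fun z => Real.exp (-‖z‖ ^ 2))
    integrable_monomial_mul_complexGaussian
    (fun m n h => integral_monomial_mul_complexGaussian_of_ne h.ne)
    integral_monomial_mul_complexGaussian_self hf
  have e : ∀ z : ι → ℂ, substPowers (fun n (z : ℂ) => z ^ n) f z *
      star (substPowers (fun n (z : ℂ) => z ^ n) f z) * ∏ i, (Real.exp (-‖z i‖ ^ 2) : ℂ) =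
      ((‖MvPolynomial.eval z f‖ ^ 2 * ∏ i, Real.exp (-‖z i‖ ^ 2) : ℝ) : ℂ) := by
    intro z
    rw [substPowers_pow (fun z => z), Complex.star_def, Complex.mul_conj,
      Complex.normSq_eq_norm_sq]
    push_cast
    rfl
  simp only [e] at h
  rw [integral_complex_ofReal] at h
  exact_mod_cast h

/-- With `A = f` and `B` its Hermite version, `⟨A, B⟩` and `⟨B, B⟩` both equal the left-hand side,
so `‖A - B‖² ≥ 0` says that `‖A‖²` is at least this value. -/
theorem le_integral_realGaussian_normSq_eval {ι : Type*} [Fintype ι] {f : MvPolynomial ι ℂ} {s : ℕ}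
    (hf : f.IsHomogeneous s) :
    (∫ x : ℝ, Real.exp (-x ^ 2 / 2)) ^ Fintype.card ι * fischerNormSq f ≤
      ∫ x : ι → ℝ, ‖MvPolynomial.eval (fun i => (x i : ℂ)) f‖ ^ 2 *
        ∏ i, Real.exp (-x i ^ 2 / 2) := by
  set w : ℝ → ℝ := fun x => Real.exp (-x ^ 2 / 2) with hw
  set P : (ℕ → Polynomial ℝ) → ℕ → ℝ → ℂ := fun p n x => (((p n).eval x : ℝ) : ℂ) with hP
  have hint : ∀ (p q : ℕ → Polynomial ℝ) m n,
      Integrable (fun x => P p m x * star (P q n x) * (w x : ℂ)) volume := by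
    intro p q m n
    refine ((integrable_polynomial_mul_gaussian (p m * q n)).ofReal (𝕜 := ℂ)).congr
      (.of_forall fun x => ?_)
    simp [hP, hw]
  have hval : ∀ (p : ℕ → Polynomial ℝ) m n, (p m).natDegree ≤ n →
      ∫ x, P p m x * star (P realHermite n x) * (w x : ℂ) =
        ((n.factorial * (p m).coeff n * ∫ x, w x : ℝ) : ℂ) := by
    intro p m n hmn
    rw [← integral_mul_realHermite_of_natDegree_le hmn, ← integral_complex_ofReal]
    congr 1
    ext x
    simp [hP, hw]
  have horth : ∀ p : ℕ → Polynomial ℝ, (∀ n, (p n).natDegree = n) → (∀ n, (p n).coeff n = 1) →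
      ∫ x : ι → ℝ, substPowers (P p) f x * star (substPowers (P realHermite) f x) *
        ∏ i, (w (x i) : ℂ) = (((∫ x, w x) ^ Fintype.card ι * fischerNormSq f : ℝ) : ℂ) := by
    intro p hd hc
    refine integral_substPowers_mul_star (μ := volume) (hint p realHermite) ?_ ?_ hf
    · intro m n h
      rw [hval _ _ _ ((hd m).le.trans h.le),
        Polynomial.coeff_eq_zero_of_natDegree_lt (by simp [hd, h])]
      simp
    · intro n
      rw [hval _ _ _ (hd n).le, hc]
      simp
  set A := substPowers (ι := ι) (P fun n => Polynomial.X ^ n) f with hA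
  set B := substPowers (ι := ι) (P realHermite) f with hB
  have h1 := horth (fun n => Polynomial.X ^ n) (by simp) (by simp)
  have h2 := horth realHermite natDegree_realHermite coeff_realHermite_self
  rw [← hA] at h1
  rw [← hB] at h2
  have i0 := (integrable_substPowers_mul_star
    (hint (fun n => Polynomial.X ^ n) fun n => Polynomial.X ^ n) f).re
  have i1 := (integrable_substPowers_mul_star
    (hint (fun n => Polynomial.X ^ n) realHermite) f).re
  have i2 := (integrable_substPowers_mul_star (hint realHermite realHermite) f).re
  rw [← hA] at i0
  rw [← hA, ← hB] at i1
  rw [← hB] at i2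
  have r1 := congrArg Complex.re h1
  have r2 := congrArg Complex.re h2
  rw [Complex.ofReal_re] at r1 r2
  have c1 := integral_re (integrable_substPowers_mul_star
    (hint (fun n => Polynomial.X ^ n) realHermite) f)
  have c2 := integral_re (integrable_substPowers_mul_star (hint realHermite realHermite) f)
  rw [← hA, ← hB] at c1
  rw [← hB] at c2
  -- Pointwise `2 Re(A B̄) ≤ |A|² + |B|²`, integrated against the weight.
  have hle := integral_mono (i1.const_mul 2) (i0.add i2) fun x => by
    have hw0 : 0 ≤ ∏ i, w (x i) := Finset.prod_nonneg fun i _ => (Real.exp_pos _).le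
    have : RCLike.re (A x * star (A x) * ∏ i, (w (x i) : ℂ)) +
        RCLike.re (B x * star (B x) * ∏ i, (w (x i) : ℂ)) -
        2 * RCLike.re (A x * star (B x) * ∏ i, (w (x i) : ℂ)) =
        Complex.normSq (A x - B x) * ∏ i, w (x i) := by
      rw [← Complex.ofReal_prod]
      simp only [RCLike.re_eq_complex_re, Complex.normSq_apply, Complex.ofReal_re,
        Complex.ofReal_im, Complex.mul_re, Complex.star_def, Complex.conj_re, Complex.conj_im,
        Complex.sub_re, Complex.sub_im]
      ring
    rw [← sub_nonneg, Pi.add_apply, this]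
    exact mul_nonneg (Complex.normSq_nonneg _) hw0
  rw [integral_add' i0 i2, integral_const_mul] at hle
  have hfin : ∫ x : ι → ℝ, RCLike.re (A x * star (A x) * ∏ i, (w (x i) : ℂ)) =
      ∫ x : ι → ℝ, ‖MvPolynomial.eval (fun i => (x i : ℂ)) f‖ ^ 2 * ∏ i, w (x i) := by
    refine integral_congr_ae (.of_forall fun x => ?_)
    have hAx : A x = MvPolynomial.eval (fun i => (x i : ℂ)) f := by
      rw [← substPowers_pow, hA]
      simp [substPowers, hP]
    simp only
    rw [hAx, Complex.star_def, Complex.mul_conj, Complex.normSq_eq_norm_sq, ← Complex.ofReal_prod,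
      ← Complex.ofReal_mul]
    exact Complex.ofReal_re _
  have d1 := c1.trans r1
  have d2 := c2.trans r2
  rw [d1, d2] at hle
  rw [← hfin]
  refine le_of_add_le_add_right (a := (∫ x, w x) ^ Fintype.card ι * fischerNormSq f) ?_
  rw [← two_mul]
  exact hle

/-! ### Polar coordinates: from Gaussian to spherical means -/

section Polar

variable {E : Type*} [NormedAddCommGroup E] [NormedSpace ℝ E] [FiniteDimensional ℝ E]
  [MeasurableSpace E] [BorelSpace E]

theorem integral_uniformSphere (F : E → ℝ) :
    ∫ x, F x.1 ∂uniformSphere E =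
      ((Measure.addHaar : Measure E).toSphere.real Set.univ)⁻¹ *
        ∫ x, F x.1 ∂(Measure.addHaar : Measure E).toSphere := by
  rw [uniformSphere, integral_smul_measure, ENNReal.toReal_inv, smul_eq_mul]
  rfl

variable [Nontrivial E]

theorem integral_mul_radial_of_homogeneous (μ : Measure E) [μ.IsAddHaarMeasure] {F : E → ℝ} {k : ℕ}
    (hF : ∀ (r : ℝ) (x : E), 0 < r → F (r • x) = r ^ k * F x) (g : ℝ → ℝ) :
    ∫ x, F x * g ‖x‖ ∂μ = (∫ x, F x.1 ∂μ.toSphere) *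
      ∫ r in Set.Ioi (0 : ℝ), r ^ (Module.finrank ℝ E - 1 + k) * g r := by
  have h1 : ∫ x, F x * g ‖x‖ ∂μ =
      ∫ x : ({(0)}ᶜ : Set E), F x.1 * g ‖x.1‖ ∂(μ.comap (↑)) := by
    rw [integral_subtype_comap (measurableSet_singleton _).compl fun x => F x * g ‖x‖,
      restrict_compl_singleton]
  have h2 : ∫ x : ({(0)}ᶜ : Set E), F x.1 * g ‖x.1‖ ∂(μ.comap (↑)) =
      ∫ y, F y.1.1 * (y.2.1 ^ k * g y.2.1)
        ∂μ.toSphere.prod (.volumeIoiPow (Module.finrank ℝ E - 1)) := by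
    rw [← μ.measurePreserving_homeomorphUnitSphereProd.integral_comp
      (Homeomorph.measurableEmbedding _)]
    refine integral_congr_ae (.of_forall fun x => ?_)
    have hx : 0 < ‖x.1‖ := norm_pos_iff.2 x.2
    simp only [homeomorphUnitSphereProd_apply_snd_coe, homeomorphUnitSphereProd_apply_fst_coe]
    have := hF ‖x.1‖ (‖x.1‖⁻¹ • x.1) hx
    rw [smul_smul, mul_inv_cancel₀ hx.ne', one_smul] at this
    rw [this]
    ring
  rw [h1, h2, integral_prod_mul (fun y : Metric.sphere (0 : E) 1 => F y.1)
    (fun r : Set.Ioi (0 : ℝ) => r.1 ^ k * g r.1)]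
  congr 1
  simp only [Measure.volumeIoiPow, ENNReal.ofReal]
  rw [integral_withDensity_eq_integral_smul
      ((measurable_subtype_coe.pow_const _).real_toNNReal),
    integral_subtype_comap measurableSet_Ioi
      fun a => Real.toNNReal (a ^ (Module.finrank ℝ E - 1)) • (a ^ k * g a)]
  refine setIntegral_congr_fun measurableSet_Ioi fun x hx => ?_
  rw [NNReal.smul_def, Real.coe_toNNReal _ (pow_nonneg (Set.mem_Ioi.1 hx).le _), smul_eq_mul,
    pow_add, mul_assoc]

theorem integral_pow_mul_exp_neg_mul_sq {b : ℝ} (hb : 0 < b) (k : ℕ) :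
    ∫ r in Set.Ioi (0 : ℝ), r ^ k * Real.exp (-b * r ^ 2) =
      b ^ (-((k : ℝ) + 1) / 2) * (1 / 2) * Real.Gamma (((k : ℝ) + 1) / 2) := by
  have := integral_rpow_mul_exp_neg_mul_rpow (p := 2) (q := k) (b := b) (by norm_num)
    (by linarith [(Nat.cast_nonneg k : (0 : ℝ) ≤ k)]) hb
  simpa only [Real.rpow_natCast, Real.rpow_ofNat] using this

/-- Each further factor `r²` costs one use of `Γ(t + 1) = t Γ(t)`. -/
theorem integral_pow_mul_exp_neg_mul_sq_add {b : ℝ} (hb : 0 < b) (k s : ℕ) :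
    ∫ r in Set.Ioi (0 : ℝ), r ^ (k + 2 * s) * Real.exp (-b * r ^ 2) =
      (∏ i ∈ Finset.range s, (((k : ℝ) + 1) / 2 + i) / b) *
        ∫ r in Set.Ioi (0 : ℝ), r ^ k * Real.exp (-b * r ^ 2) := by
  induction s with
  | zero => simp
  | succ s ih =>
    rw [Finset.prod_range_succ, mul_right_comm, ← ih, integral_pow_mul_exp_neg_mul_sq hb,
      integral_pow_mul_exp_neg_mul_sq hb]
    have e1 : (((k + 2 * (s + 1) : ℕ) : ℝ) + 1) / 2 = (((k + 2 * s : ℕ) : ℝ) + 1) / 2 + 1 := by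
      push_cast; ring
    have e2 : -(((k + 2 * (s + 1) : ℕ) : ℝ) + 1) / 2 = -(((k + 2 * s : ℕ) : ℝ) + 1) / 2 - 1 := by
      push_cast; ring
    rw [e1, e2, Real.Gamma_add_one (by positivity), Real.rpow_sub_one hb.ne']
    push_cast
    ring

instance : IsProbabilityMeasure (uniformSphere E) := by
  constructor
  rw [uniformSphere, Measure.smul_apply, smul_eq_mul]
  exact ENNReal.inv_mul_cancel (Measure.measure_univ_ne_zero.2 (Measure.toSphere_ne_zero _))
    (measure_ne_top _ _)

/-- Comparison of spherical and Gaussian averages of a homogeneous function. -/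
theorem integral_uniformSphere_mul_gaussian (μ : Measure E) [μ.IsAddHaarMeasure] {F : E → ℝ} {s : ℕ}
    (hF : ∀ (r : ℝ) (x : E), 0 < r → F (r • x) = r ^ (2 * s) * F x) {b : ℝ} (hb : 0 < b) :
    (∫ x, F x.1 ∂uniformSphere E) *
        (∏ i ∈ Finset.range s, ((Module.finrank ℝ E : ℝ) / 2 + i) / b) *
        ∫ x, Real.exp (-b * ‖x‖ ^ 2) ∂μ =
      ∫ x, F x * Real.exp (-b * ‖x‖ ^ 2) ∂μ := by
  -- Both sides are linear in `μ`, and Haar measures are proportional.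
  wlog hμ : μ = Measure.addHaar generalizing μ
  · rw [μ.isAddLeftInvariant_eq_smul Measure.addHaar, integral_smul_nnreal_measure,
      integral_smul_nnreal_measure, mul_smul_comm, this Measure.addHaar rfl]
  subst hμ
  have h0 := integral_mul_radial_of_homogeneous (Measure.addHaar : Measure E) (F := fun _ => 1)
    (k := 0) (by simp) (fun r => Real.exp (-b * r ^ 2))
  have h1 := integral_mul_radial_of_homogeneous (Measure.addHaar : Measure E) hF
    (fun r => Real.exp (-b * r ^ 2))
  have hd : ((Module.finrank ℝ E - 1 : ℕ) : ℝ) + 1 = Module.finrank ℝ E := by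
    rw [Nat.cast_sub Module.finrank_pos]; simp
  have hpos : (Measure.addHaar : Measure E).toSphere.real Set.univ ≠ 0 := by
    rw [measureReal_def, ENNReal.toReal_ne_zero]
    exact ⟨Measure.measure_univ_ne_zero.2 (Measure.toSphere_ne_zero _), measure_ne_top _ _⟩
  rw [integral_pow_mul_exp_neg_mul_sq_add hb, hd] at h1
  simp only [one_mul, integral_const, smul_eq_mul, mul_one, add_zero] at h0
  rw [h0, h1, integral_uniformSphere]
  field_simp

end Polar

/-! ### Comparison of the real and complex spherical means -/

variable {d : ℕ}

theorem isAddHaarMeasure_map_toLp {𝕜 : Type*} [RCLike 𝕜] [MeasurableSpace 𝕜] [BorelSpace 𝕜]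
    (ν : Measure (Fin d → 𝕜)) [ν.IsAddHaarMeasure] :
    (ν.map (WithLp.toLp 2) : Measure (EuclideanSpace 𝕜 (Fin d))).IsAddHaarMeasure :=
  (PiLp.continuousLinearEquiv 2 𝕜 fun _ : Fin d => 𝕜).symm.isAddHaarMeasure_map ν

theorem integral_map_toLp {𝕜 : Type*} [MeasurableSpace 𝕜] (ν : Measure (Fin d → 𝕜))
    (F : WithLp 2 (Fin d → 𝕜) → ℝ) :
    ∫ x, F x ∂(ν.map (WithLp.toLp 2)) = ∫ x, F (WithLp.toLp 2 x) ∂ν :=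
  (MeasurableEquiv.toLp 2 (Fin d → 𝕜)).measurableEmbedding.integral_map F

theorem eval_smul_of_isHomogeneous {ι : Type*} {f : MvPolynomial ι ℂ} {s : ℕ}
    (hf : f.IsHomogeneous s) (r : ℂ) (x : ι → ℂ) :
    MvPolynomial.eval (fun i => r * x i) f = r ^ s * MvPolynomial.eval x f := by
  rw [MvPolynomial.eval_eq, MvPolynomial.eval_eq, Finset.mul_sum]
  refine Finset.sum_congr rfl fun β hβ => ?_
  have : ∑ i ∈ β.support, β i = s := by
    have := hf (MvPolynomial.mem_support_iff.1 hβ)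
    simpa [Finsupp.weight_apply, Finsupp.sum] using this
  simp only [mul_pow, Finset.prod_mul_distrib, Finset.prod_pow_eq_pow_sum, this]
  ring

theorem measurable_realToComplex : Measurable (realToComplex (d := d)) := by
  unfold realToComplex
  fun_prop

theorem integral_complexHaar (F : EuclideanSpace ℂ (Fin d) → ℝ) :
    ∫ x, F x ∂complexHaar d = ∫ x, F x.1 ∂uniformSphere (EuclideanSpace ℂ (Fin d)) := by
  rw [complexHaar]
  exact (MeasurableEmbedding.subtype_coe Metric.isClosed_sphere.measurableSet).integral_map F

theorem integral_realHaar {F : EuclideanSpace ℂ (Fin d) → ℝ} (hF : Continuous F) :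
    ∫ x, F x ∂realHaar d =
      ∫ x, F (realToComplex x.1) ∂uniformSphere (EuclideanSpace ℝ (Fin d)) := by
  rw [realHaar]
  exact integral_map (measurable_realToComplex.comp measurable_subtype_coe).aemeasurable
    hF.aestronglyMeasurable

theorem continuous_normSq_eval (f : MvPolynomial (Fin d) ℂ) :
    Continuous fun x : EuclideanSpace ℂ (Fin d) => ‖MvPolynomial.eval x.ofLp f‖ ^ 2 := by
  have := MvPolynomial.continuous_eval f
  fun_prop

/-- The ratio between the normalizations of the complex and the real spherical moments. -/
def haarRatio (d s : ℕ) : ℝ := ∏ i ∈ Finset.range s, ((d : ℝ) + i) / (d + 2 * i)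

theorem integral_complexHaar_normSq_eval [NeZero d] {f : MvPolynomial (Fin d) ℂ} {s : ℕ}
    (hf : f.IsHomogeneous s) :
    (∫ x, ‖MvPolynomial.eval x.ofLp f‖ ^ 2 ∂complexHaar d) *
      ∏ i ∈ Finset.range s, ((d : ℝ) + i) = fischerNormSq f := by
  have := isAddHaarMeasure_map_toLp (𝕜 := ℂ) (d := d) volume
  have h := integral_uniformSphere_mul_gaussian
    ((volume : Measure (Fin d → ℂ)).map (WithLp.toLp 2))
    (F := fun x : EuclideanSpace ℂ (Fin d) => ‖MvPolynomial.eval x.ofLp f‖ ^ 2) (s := s)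
    (fun r x hr => by
      have := eval_smul_of_isHomogeneous hf (r : ℂ) x.ofLp
      have e : (r • x).ofLp = fun i => (r : ℂ) * x.ofLp i := by ext i; simp
      rw [e, this, norm_mul, norm_pow, Complex.norm_real, Real.norm_of_nonneg hr.le, mul_pow,
        ← pow_mul, mul_comm s 2]) one_pos
  rw [integral_map_toLp, integral_map_toLp,
    ← integral_complexHaar (fun x => ‖MvPolynomial.eval x.ofLp f‖ ^ 2)] at h
  have hexp : ∀ x : Fin d → ℂ, Real.exp (-1 * ‖(WithLp.toLp 2 x : EuclideanSpace ℂ (Fin d))‖ ^ 2) =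
      ∏ i, Real.exp (-‖x i‖ ^ 2) := by
    intro x
    rw [EuclideanSpace.norm_sq_eq, ← Real.exp_sum]
    simp
  -- Real dimension `2d` and `b = 1` make the radial factors `d + i`; on the real sphere, dimension
  -- `d` and `b = 1/2` make them `d + 2i`.
  have hdim : (Module.finrank ℝ (EuclideanSpace ℂ (Fin d)) : ℝ) = 2 * d := by
    rw [← Module.finrank_mul_finrank ℝ ℂ]
    simp
  simp only [hexp, integral_complexGaussian_normSq_eval hf, hdim] at h
  -- The constant polynomial gives the total Gaussian mass, which then cancels.
  have h1 := integral_complexGaussian_normSq_eval (MvPolynomial.isHomogeneous_one (Fin d) ℂ)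
  have hone : fischerNormSq (1 : MvPolynomial (Fin d) ℂ) = 1 := by
    simp [fischerNormSq]
  simp only [map_one, norm_one, one_pow, one_mul, hone, mul_one] at h1
  rw [h1, mul_comm] at h
  have := mul_left_cancel₀ (by positivity) h
  rw [← this]
  congr 1
  exact Finset.prod_congr rfl fun i _ => by ring

theorem le_integral_realHaar_normSq_eval [NeZero d] {f : MvPolynomial (Fin d) ℂ} {s : ℕ}
    (hf : f.IsHomogeneous s) :
    fischerNormSq f ≤ (∫ x, ‖MvPolynomial.eval x.ofLp f‖ ^ 2 ∂realHaar d) *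
      ∏ i ∈ Finset.range s, ((d : ℝ) + 2 * i) := by
  have := isAddHaarMeasure_map_toLp (𝕜 := ℝ) (d := d) volume
  have h := integral_uniformSphere_mul_gaussian
    ((volume : Measure (Fin d → ℝ)).map (WithLp.toLp 2))
    (F := fun x : EuclideanSpace ℝ (Fin d) => ‖MvPolynomial.eval (realToComplex x).ofLp f‖ ^ 2)
    (s := s)
    (fun r x hr => by
      have := eval_smul_of_isHomogeneous hf (r : ℂ) (realToComplex x).ofLp
      have e : (realToComplex (r • x)).ofLp = fun i => (r : ℂ) * (realToComplex x).ofLp i := by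
        ext i; simp [realToComplex]
      rw [e, this, norm_mul, norm_pow, Complex.norm_real, Real.norm_of_nonneg hr.le, mul_pow,
        ← pow_mul, mul_comm s 2]) (b := 1 / 2) (by norm_num)
  rw [integral_map_toLp, integral_map_toLp, ← integral_realHaar (continuous_normSq_eval f)] at h
  have hexp : ∀ x : Fin d → ℝ,
      Real.exp (-(1 / 2) * ‖(WithLp.toLp 2 x : EuclideanSpace ℝ (Fin d))‖ ^ 2) =
        ∏ i, Real.exp (-x i ^ 2 / 2) := by
    intro x
    rw [EuclideanSpace.norm_sq_eq, ← Real.exp_sum, Finset.mul_sum]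
    congr 1
    refine Finset.sum_congr rfl fun i _ => ?_
    simp
    ring
  simp only [hexp, finrank_euclideanSpace, Fintype.card_fin] at h
  have h1 : ∫ x : Fin d → ℝ, ∏ i, Real.exp (-x i ^ 2 / 2) =
      (∫ x : ℝ, Real.exp (-x ^ 2 / 2)) ^ d := by
    rw [integral_fintype_prod_volume_eq_pow (fun x : ℝ => Real.exp (-x ^ 2 / 2)), Fintype.card_fin]
  have hZ : 0 < ∫ x : ℝ, Real.exp (-x ^ 2 / 2) := by
    have := integral_gaussian (1 / 2)
    have e : ∀ x : ℝ, -(1 / 2) * x ^ 2 = -x ^ 2 / 2 := fun x => by ring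
    simp only [e] at this
    rw [this]
    positivity
  have h2 := le_integral_realGaussian_normSq_eval hf
  rw [Fintype.card_fin] at h2
  have h3 : (∫ x : ℝ, Real.exp (-x ^ 2 / 2)) ^ d * fischerNormSq f ≤
      (∫ x : ℝ, Real.exp (-x ^ 2 / 2)) ^ d * _ :=
    h2.trans (h.symm.le.trans (by rw [h1, mul_comm]))
  refine (le_of_mul_le_mul_left h3 (by positivity)).trans_eq ?_
  congr 1
  exact Finset.prod_congr rfl fun i _ => by ring

/-- For a homogeneous polynomial `f`, the mean of `|f|²` over the real sphere is at least
`haarRatio d s` times its mean over the complex sphere. -/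
theorem haarRatio_mul_integral_normSq_eval_le [NeZero d] {f : MvPolynomial (Fin d) ℂ} {s : ℕ}
    (hf : f.IsHomogeneous s) :
    haarRatio d s * ∫ x, ‖MvPolynomial.eval x.ofLp f‖ ^ 2 ∂complexHaar d ≤
      ∫ x, ‖MvPolynomial.eval x.ofLp f‖ ^ 2 ∂realHaar d := by
  have hd : (0 : ℝ) < d := by exact_mod_cast Nat.pos_of_ne_zero (NeZero.ne d)
  have h1 := integral_complexHaar_normSq_eval hf
  have h2 := le_integral_realHaar_normSq_eval hf
  rw [← h1] at h2
  rw [haarRatio, Finset.prod_div_distrib, div_mul_eq_mul_div,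
    div_le_iff₀ (Finset.prod_pos fun i _ => by positivity), mul_comm]
  exact h2

theorem haarRatio_nonneg (d s : ℕ) : 0 ≤ haarRatio d s :=
  Finset.prod_nonneg fun i _ => by positivity

theorem haarRatio_succ_le (d s : ℕ) : haarRatio d (s + 1) ≤ haarRatio d s := by
  rw [haarRatio, Finset.prod_range_succ]
  refine mul_le_of_le_one_right (haarRatio_nonneg d s) (div_le_one_of_le₀ ?_ (by positivity))
  linarith [(Nat.cast_nonneg s : (0 : ℝ) ≤ s)]

theorem haarRatio_antitone (d : ℕ) : Antitone (haarRatio d) :=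
  antitone_nat_of_succ_le (haarRatio_succ_le d)

theorem haarRatio_le_one (d s : ℕ) : haarRatio d s ≤ 1 := by
  simpa [haarRatio] using haarRatio_antitone d (Nat.zero_le s)

/-- The factor of index `i` is at least `1 - i/d`, so the losses add up to at most `∑_{i<s} i/d ≤
s²/(2d)`. -/
theorem one_sub_haarRatio_le [NeZero d] (s : ℕ) : 1 - haarRatio d s ≤ (s : ℝ) ^ 2 / (2 * d) := by
  have hd : (0 : ℝ) < d := by exact_mod_cast Nat.pos_of_ne_zero (NeZero.ne d)
  induction s with
  | zero => simp [haarRatio]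
  | succ s ih =>
    have h1 : haarRatio d (s + 1) = haarRatio d s * (((d : ℝ) + s) / (d + 2 * s)) :=
      Finset.prod_range_succ _ _
    have h2 : 1 - (s : ℝ) / d ≤ ((d : ℝ) + s) / (d + 2 * s) := by
      rw [le_div_iff₀ (by positivity)]
      have : (1 - (s : ℝ) / d) * (d + 2 * s) = d + s - 2 * s ^ 2 / d := by field_simp; ring
      rw [this]
      linarith [show (0 : ℝ) ≤ 2 * (s : ℝ) ^ 2 / d by positivity]
    have h3 := mul_le_mul_of_nonneg_left h2 (haarRatio_nonneg d s)
    have h4 : haarRatio d s * ((s : ℝ) / d) ≤ s / d :=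
      mul_le_of_le_one_left (by positivity) (haarRatio_le_one d s)
    have h5 : ((s + 1 : ℕ) : ℝ) ^ 2 / (2 * d) = (s : ℝ) ^ 2 / (2 * d) + s / d + 1 / (2 * d) := by
      push_cast; field_simp; ring
    have h6 : (0 : ℝ) ≤ 1 / (2 * d) := by positivity
    rw [h1, h5]
    linarith

/-! ### The two laws: normalization and integrability -/

section Laws

instance [NeZero d] : IsProbabilityMeasure (realHaar d) :=
  Measure.isProbabilityMeasure_map
    (measurable_realToComplex.comp measurable_subtype_coe).aemeasurable

instance [NeZero d] : IsProbabilityMeasure (complexHaar d) :=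
  Measure.isProbabilityMeasure_map measurable_subtype_coe.aemeasurable

theorem continuous_realToComplex : Continuous (realToComplex (d := d)) := by
  unfold realToComplex
  fun_prop

theorem norm_realToComplex (x : EuclideanSpace ℝ (Fin d)) : ‖realToComplex x‖ = ‖x‖ := by
  simp [EuclideanSpace.norm_eq, realToComplex]

theorem ae_realHaar_norm_eq_one : ∀ᵐ x ∂realHaar d, ‖x‖ = 1 := by
  rw [realHaar]
  refine (ae_map_iff (measurable_realToComplex.comp measurable_subtype_coe).aemeasurable
    (measurableSet_eq_fun measurable_norm measurable_const)).2 ?_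
  exact .of_forall fun x => by simp [norm_realToComplex]

theorem ae_complexHaar_norm_eq_one : ∀ᵐ x ∂complexHaar d, ‖x‖ = 1 := by
  rw [complexHaar, ae_map_iff measurable_subtype_coe.aemeasurable
    (measurableSet_eq_fun measurable_norm measurable_const)]
  exact .of_forall fun x => by simp

variable {G : Type*} [NormedAddCommGroup G] [NeZero d] {F : EuclideanSpace ℂ (Fin d) → G}

theorem integrable_realHaar (hF : Continuous F) : Integrable F (realHaar d) := by
  have hm : Measurable fun x : Metric.sphere (0 : EuclideanSpace ℝ (Fin d)) 1 =>
      realToComplex x.1 := measurable_realToComplex.comp measurable_subtype_coe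
  rw [realHaar, integrable_map_measure hF.aestronglyMeasurable hm.aemeasurable]
  exact (hF.comp (continuous_realToComplex.comp
    continuous_subtype_val)).integrable_of_hasCompactSupport (HasCompactSupport.of_compactSpace _)

theorem integrable_complexHaar (hF : Continuous F) : Integrable F (complexHaar d) := by
  rw [complexHaar, integrable_map_measure hF.aestronglyMeasurable
    measurable_subtype_coe.aemeasurable]
  exact (hF.comp continuous_subtype_val).integrable_of_hasCompactSupport
    (HasCompactSupport.of_compactSpace _)

end Laws

/-! ### Output probabilities as sums of squared polynomials -/

namespace QAlg

variable {n C : ℕ}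

theorem outputProb_nonneg (x : Fin C → EuclideanSpace ℂ (Fin (2 ^ n))) (k : Fin C) {m : ℕ}
    (A : QAlg n C m) (v : Fin m → ℂ) : 0 ≤ outputProb x k A v := by
  induction A with
  | output k' =>
    rw [outputProb]
    split_ifs
    · positivity
    · exact le_rfl
  | copy i next ih => exact ih _
  | operation K h next ih => exact Finset.sum_nonneg fun j _ => ih j _

theorem sum_normSq_adjoin {m d : ℕ} (v : Fin m → ℂ) {x : EuclideanSpace ℂ (Fin d)} (hx : ‖x‖ = 1) :
    ∑ a, ‖adjoin v x.ofLp a‖ ^ 2 = ∑ a, ‖v a‖ ^ 2 := by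
  have h : ∑ b, ‖x.ofLp b‖ ^ 2 = 1 := by rw [← EuclideanSpace.norm_sq_eq, hx, one_pow]
  simp only [adjoin]
  rw [← finProdFinEquiv.sum_comp, Fintype.sum_prod_type]
  refine Finset.sum_congr rfl fun a _ => ?_
  have e : ∀ b : Fin d, (finProdFinEquiv (a, b)).divNat = a ∧ (finProdFinEquiv (a, b)).modNat = b :=
    fun b => Prod.mk.inj (finProdFinEquiv.symm_apply_apply (a, b))
  simp only [(e _).1, (e _).2, norm_mul, mul_pow]
  rw [← Finset.mul_sum, h, mul_one]

theorem sum_normSq_mulVec {m m' r : ℕ} {K : Fin r → Matrix (Fin m') (Fin m) ℂ}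
    (hK : ∑ j, (K j)ᴴ * K j = 1) (v : Fin m → ℂ) :
    ∑ j, ∑ a, ‖(K j *ᵥ v) a‖ ^ 2 = ∑ a, ‖v a‖ ^ 2 := by
  have hn : ∀ {l : ℕ} (w : Fin l → ℂ), ((∑ a, ‖w a‖ ^ 2 : ℝ) : ℂ) = star w ⬝ᵥ w := by
    intro l w
    simp only [dotProduct, Pi.star_apply, Complex.star_def, Complex.conj_mul']
    push_cast
    rfl
  rw [← Complex.ofReal_inj, Complex.ofReal_sum]
  simp only [hn]
  calc ∑ j, star (K j *ᵥ v) ⬝ᵥ (K j *ᵥ v) = ∑ j, star v ⬝ᵥ (((K j)ᴴ * K j) *ᵥ v) := by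
        refine Finset.sum_congr rfl fun j _ => ?_
        rw [Matrix.star_mulVec, ← Matrix.mulVec_mulVec, Matrix.dotProduct_mulVec _ (K j)ᴴ]
    _ = star v ⬝ᵥ v := by
        rw [← dotProduct_sum, ← Matrix.sum_mulVec, hK, Matrix.one_mulVec]

theorem sum_outputProb {x : Fin C → EuclideanSpace ℂ (Fin (2 ^ n))} (hx : ∀ i, ‖x i‖ = 1) {m : ℕ}
    (A : QAlg n C m) (v : Fin m → ℂ) : ∑ k, outputProb x k A v = ∑ a, ‖v a‖ ^ 2 := by
  induction A with
  | output k' => simp [outputProb]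
  | copy i next ih =>
    simp only [outputProb]
    rw [ih, sum_normSq_adjoin v (hx i)]
  | operation K h next ih =>
    simp only [outputProb]
    rw [Finset.sum_comm]
    simp only [ih]
    exact sum_normSq_mulVec h v

theorem continuous_outputProb (k : Fin C) {m : ℕ} (A : QAlg n C m) {T : Type*} [TopologicalSpace T]
    {x : T → Fin C → EuclideanSpace ℂ (Fin (2 ^ n))} {v : T → Fin m → ℂ} (hx : Continuous x)
    (hv : Continuous v) : Continuous fun t => outputProb (x t) k A (v t) := by
  induction A with
  | output k' =>
    simp only [outputProb]
    split_ifs <;> fun_prop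
  | copy i next ih =>
    refine ih (continuous_pi fun a => ?_)
    simp only [adjoin]
    fun_prop
  | operation K h next ih =>
    exact continuous_finsetSum _ fun j _ => ih j (continuous_const.matrix_mulVec hv)

theorem copies_le_time (i : Fin C) {m : ℕ} (A : QAlg n C m) : copies i A ≤ time A := by
  induction A with
  | output k' => exact le_rfl
  | copy i' next ih =>
    simp only [copies, time]
    split_ifs <;> omega
  | operation K h next ih =>
    exact (Finset.sup_mono_fun fun j _ => ih j).trans (Nat.le_add_left _ _)

/-- With the other vectors fixed, the register holds homogeneous polynomials in `y`: a copy of `x_k`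
raises the degree by one, other copies multiply by constants, and Kraus operators take linear
combinations. Branches may end in different degrees, so `N` only bounds them, and
`haarRatio_antitone` absorbs the slack at the outputs. -/
theorem haarRatio_mul_integral_outputProb_le (x : Fin C → EuclideanSpace ℂ (Fin (2 ^ n)))
    (k k' : Fin C) {N m : ℕ} (A : QAlg n C m) {s : ℕ} {p : Fin m → MvPolynomial (Fin (2 ^ n)) ℂ}
    (hp : ∀ a, (p a).IsHomogeneous s) (hN : s + copies k A ≤ N) :
    haarRatio (2 ^ n) N * ∫ y, outputProb (Function.update x k y) k' A
        (fun a => MvPolynomial.eval y.ofLp (p a)) ∂complexHaar (2 ^ n) ≤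
      ∫ y, outputProb (Function.update x k y) k' A
        (fun a => MvPolynomial.eval y.ofLp (p a)) ∂realHaar (2 ^ n) := by
  induction A generalizing s with
  | output l =>
    simp only [outputProb]
    split_ifs
    · rw [integral_finsetSum _ fun a _ => integrable_complexHaar (continuous_normSq_eval _),
        integral_finsetSum _ fun a _ => integrable_realHaar (continuous_normSq_eval _),
        Finset.mul_sum]
      refine Finset.sum_le_sum fun a _ => (mul_le_mul_of_nonneg_right
        (haarRatio_antitone _ (Nat.le_of_add_right_le hN))
        (integral_nonneg fun _ => by positivity)).trans
        (haarRatio_mul_integral_normSq_eval_le (hp a))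
    · simp
  | copy i next ih =>
    simp only [outputProb]
    rw [copies] at hN
    by_cases h : i = k
    · subst h
      rw [if_pos rfl] at hN
      have := ih (s := s + 1) (p := fun a => p a.divNat * MvPolynomial.X a.modNat)
        (fun a => (hp _).mul (MvPolynomial.isHomogeneous_X _ _)) (by omega)
      simp only [map_mul, MvPolynomial.eval_X] at this
      simp only [Function.update_self]
      exact this
    · rw [if_neg h] at hN
      have := ih (s := s) (p := fun a => p a.divNat * MvPolynomial.C (x i a.modNat))
        (fun a => (hp _).mul (MvPolynomial.isHomogeneous_C _ _)) (by omega)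
      simp only [map_mul, MvPolynomial.eval_C] at this
      simp only [Function.update_of_ne h]
      exact this
  | operation K h next ih =>
    simp only [outputProb]
    have hc : ∀ j, Continuous fun y : EuclideanSpace ℂ (Fin (2 ^ n)) =>
        outputProb (Function.update x k y) k' (next j)
          (K j *ᵥ fun a => MvPolynomial.eval y.ofLp (p a)) := by
      intro j
      refine continuous_outputProb _ _ (continuous_const.update k continuous_id)
        (continuous_const.matrix_mulVec (continuous_pi fun a => ?_))
      have := MvPolynomial.continuous_eval (p a)
      fun_prop
    rw [integral_finsetSum _ fun j _ => integrable_complexHaar (hc j),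
      integral_finsetSum _ fun j _ => integrable_realHaar (hc j), Finset.mul_sum]
    refine Finset.sum_le_sum fun j _ => ?_
    have hj : copies k (next j) ≤ copies k (operation K h next) :=
      Finset.le_sup (f := fun j => copies k (next j)) (Finset.mem_univ j)
    have := ih j (s := s) (p := fun b => ∑ a, MvPolynomial.C (K j b a) * p a)
      (fun b => MvPolynomial.IsHomogeneous.sum _ _ _ fun a _ => by
        simpa using (MvPolynomial.isHomogeneous_C _ (K j b a)).mul (hp a)) (by omega)
    simp only [map_sum, map_mul, MvPolynomial.eval_C] at this
    exact this

end QAlg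

/-! ### Averaging over the instance and the bound on success -/

theorem integral_pi_succAbove {α : Type*} [MeasurableSpace α] {c : ℕ} (μ : Fin (c + 1) → Measure α)
    [∀ i, IsProbabilityMeasure (μ i)] (k : Fin (c + 1)) {F : (Fin (c + 1) → α) → ℝ}
    (hF : Integrable F (Measure.pi μ)) :
    Integrable (fun z => ∫ y, F (k.insertNth y z) ∂μ k) (Measure.pi fun j => μ (k.succAbove j)) ∧
      ∫ x, F x ∂Measure.pi μ =
        ∫ z, ∫ y, F (k.insertNth y z) ∂μ k ∂Measure.pi fun j => μ (k.succAbove j) := by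
  have hmp := (measurePreserving_piFinSuccAbove μ k).symm
  have hI := hmp.integrable_comp_of_integrable hF
  refine ⟨hI.integral_prod_right, ?_⟩
  rw [← hmp.integral_comp (MeasurableEquiv.measurableEmbedding _)]
  exact integral_prod_symm _ hI

theorem ae_pi_norm_eq_one {d C : ℕ} {μ : Fin C → Measure (EuclideanSpace ℂ (Fin d))}
    [∀ i, IsProbabilityMeasure (μ i)] (h : ∀ i, ∀ᵐ x ∂μ i, ‖x‖ = 1) :
    ∀ᵐ x ∂Measure.pi μ, ∀ i, ‖x i‖ = 1 :=
  ae_all_iff.2 fun i => (measurePreserving_eval μ i).quasiMeasurePreserving.ae (h i)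

namespace QAlg

variable {n C : ℕ}

theorem continuous_outputProb_start (A : QAlg n C 1) (k : Fin C) :
    Continuous fun x => outputProb x k A fun _ => 1 :=
  continuous_outputProb k A continuous_id continuous_const

theorem integrable_outputProb {μ : Fin C → Measure (EuclideanSpace ℂ (Fin (2 ^ n)))}
    [∀ i, IsProbabilityMeasure (μ i)] (h : ∀ i, ∀ᵐ x ∂μ i, ‖x‖ = 1) (A : QAlg n C 1) (k : Fin C) :
    Integrable (fun x => outputProb x k A fun _ => 1) (Measure.pi μ) := by
  refine (integrable_const (1 : ℝ)).mono' (continuous_outputProb_start A k).aestronglyMeasurable ?_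
  filter_upwards [ae_pi_norm_eq_one h] with x hx
  rw [Real.norm_of_nonneg (outputProb_nonneg _ _ _ _)]
  calc outputProb x k A (fun _ => 1) ≤ ∑ l, outputProb x l A fun _ => 1 :=
        Finset.single_le_sum (f := fun l => outputProb x l A fun _ => 1)
          (fun l _ => outputProb_nonneg _ _ _ _) (Finset.mem_univ k)
    _ = 1 := by rw [sum_outputProb hx]; simp

theorem sum_integral_outputProb {μ : Fin C → Measure (EuclideanSpace ℂ (Fin (2 ^ n)))}
    [∀ i, IsProbabilityMeasure (μ i)] (h : ∀ i, ∀ᵐ x ∂μ i, ‖x‖ = 1) (A : QAlg n C 1) :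
    ∑ k, ∫ x, outputProb x k A (fun _ => 1) ∂Measure.pi μ = 1 := by
  rw [← integral_finsetSum _ fun k _ => integrable_outputProb h A k]
  rw [integral_congr_ae (g := fun _ => (1 : ℝ))]
  · simp
  · filter_upwards [ae_pi_norm_eq_one h] with x hx
    rw [sum_outputProb hx]
    simp

/-- Replacing the real vector by a complex one decreases the probability of each output at most by
the factor `haarRatio`. -/
theorem haarRatio_mul_integral_pi_complexHaar_le (A : QAlg n C 1) (k k' : Fin C) :
    haarRatio (2 ^ n) (copies k A) *
        ∫ x, outputProb x k' A (fun _ => 1) ∂(Measure.pi fun _ => complexHaar (2 ^ n)) ≤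
      ∫ x, outputProb x k' A (fun _ => 1) ∂instanceLaw n C k := by
  obtain ⟨c, rfl⟩ : ∃ c, C = c + 1 := ⟨C - 1, by have := k.pos; omega⟩
  rw [instanceLaw]
  have hprob : ∀ i : Fin (c + 1),
      IsProbabilityMeasure (if i = k then realHaar (2 ^ n) else complexHaar (2 ^ n)) := by
    intro i; split_ifs <;> infer_instance
  have hnorm : ∀ i : Fin (c + 1),
      ∀ᵐ x ∂(if i = k then realHaar (2 ^ n) else complexHaar (2 ^ n)), ‖x‖ = 1 := by
    intro i
    split_ifs
    · exact ae_realHaar_norm_eq_one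
    · exact ae_complexHaar_norm_eq_one
  obtain ⟨i1, e1⟩ := integral_pi_succAbove (fun _ : Fin (c + 1) => complexHaar (2 ^ n)) k
    (integrable_outputProb (fun _ => ae_complexHaar_norm_eq_one) A k')
  obtain ⟨i2, e2⟩ := integral_pi_succAbove
    (fun i => if i = k then realHaar (2 ^ n) else complexHaar (2 ^ n)) k
    (integrable_outputProb hnorm A k')
  simp only [if_true, Fin.succAbove_ne, if_false] at i2 e2
  rw [e1, e2, ← integral_const_mul]
  refine integral_mono (i1.const_mul _) i2 fun z => ?_
  have h := haarRatio_mul_integral_outputProb_le (k.insertNth 0 z) k k' A (s := 0)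
    (p := fun _ => 1) (fun _ => MvPolynomial.isHomogeneous_one _ _) (Nat.zero_add _).le
  simpa using h

/-- Wrong outputs keep at least the fraction `α` of their all-complex probability `1 - J k`. As the
`J k` sum to `1`, the mean error is at least `α (C - 1) / C ≥ α / 2`. -/
theorem successProb_le {A : QAlg n C 1} (hC : 2 ≤ C) {N : ℕ} (hN : ∀ k, copies k A ≤ N) :
    successProb A ≤ 1 - haarRatio (2 ^ n) N / 2 := by
  set α := haarRatio (2 ^ n) N with hα
  have hα0 : 0 ≤ α := haarRatio_nonneg _ _
  set J : Fin C → ℝ := fun k' =>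
    ∫ x, outputProb x k' A (fun _ => 1) ∂(Measure.pi fun _ => complexHaar (2 ^ n)) with hJ
  have hJ1 : ∑ k, J k = 1 := sum_integral_outputProb (fun _ => ae_complexHaar_norm_eq_one) A
  have hk : ∀ k, ∫ x, outputProb x k A (fun _ => 1) ∂instanceLaw n C k ≤ 1 - α * (1 - J k) := by
    intro k
    have hprob : ∀ i : Fin C,
        IsProbabilityMeasure (if i = k then realHaar (2 ^ n) else complexHaar (2 ^ n)) := by
      intro i; split_ifs <;> infer_instance
    have hnorm : ∀ i : Fin C,
        ∀ᵐ x ∂(if i = k then realHaar (2 ^ n) else complexHaar (2 ^ n)), ‖x‖ = 1 := by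
      intro i
      split_ifs
      · exact ae_realHaar_norm_eq_one
      · exact ae_complexHaar_norm_eq_one
    have h1 : ∑ k', ∫ x, outputProb x k' A (fun _ => 1) ∂instanceLaw n C k = 1 :=
      sum_integral_outputProb hnorm A
    have h2 : α * ∑ k' ∈ Finset.univ.erase k, J k' ≤
        ∑ k' ∈ Finset.univ.erase k, ∫ x, outputProb x k' A (fun _ => 1) ∂instanceLaw n C k := by
      rw [Finset.mul_sum]
      refine Finset.sum_le_sum fun k' _ => le_trans (mul_le_mul_of_nonneg_right
        (haarRatio_antitone _ (hN k)) (integral_nonneg fun x => outputProb_nonneg _ _ _ _))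
        (haarRatio_mul_integral_pi_complexHaar_le A k k')
    rw [← Finset.add_sum_erase _ _ (Finset.mem_univ k)] at h1 hJ1
    have h3 : ∑ k' ∈ Finset.univ.erase k, J k' = 1 - J k := by linarith
    rw [h3] at h2
    linarith
  have hsum := Finset.sum_le_sum fun k (_ : k ∈ Finset.univ) => hk k
  have hC' : (2 : ℝ) ≤ C := by exact_mod_cast hC
  have he : ∑ k, (1 - α * (1 - J k)) = C - α * (C - 1) := by
    rw [Finset.sum_sub_distrib, ← Finset.mul_sum, Finset.sum_sub_distrib, hJ1]
    simp
  rw [he] at hsum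
  rw [successProb, inv_mul_le_iff₀ (by positivity)]
  nlinarith

theorem two_rpow_le_of_successProb {A : QAlg n C 1} (hC : 2 ≤ C) (hA : 9 / 10 ≤ successProb A)
    {N : ℕ} (hN : ∀ k, copies k A ≤ N) : (2 : ℝ) ^ ((n : ℝ) / 2) ≤ N := by
  have h1 := successProb_le hC hN
  have h2 := one_sub_haarRatio_le (d := 2 ^ n) N
  have hd : (0 : ℝ) < 2 ^ n := by positivity
  push_cast at h2
  -- Success `9/10` forces `α ≤ 1/5`.
  have h3 : 4 / 5 ≤ (N : ℝ) ^ 2 / (2 * 2 ^ n) := by linarith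
  rw [le_div_iff₀ (by positivity)] at h3
  refine le_of_sq_le_sq ?_ (Nat.cast_nonneg N)
  rw [← Real.rpow_natCast, ← Real.rpow_mul (by norm_num)]
  have : (n : ℝ) / 2 * (2 : ℕ) = n := by push_cast; ring
  rw [this, Real.rpow_natCast]
  linarith

end QAlg

/-! ### Trace norm and moment operators -/

open scoped ComplexOrder

-- The singular vectors are the test families: `v i` an eigenbasis of `T* T` and `u i = T (v i) / σ
-- i`. They are restricted to a subset `s` since `u i` is undefined when `σ i = 0`.
open scoped InnerProductSpace in
theorem sum_singularValues_le_of_forall_inner_le {E : Type*} [NormedAddCommGroup E]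
    [InnerProductSpace ℂ E] [FiniteDimensional ℂ E] (T : E →ₗ[ℂ] E) {c : ℝ}
    (h : ∀ (s : Finset (Fin (Module.finrank ℂ E))) (u v : Fin (Module.finrank ℂ E) → E),
      Orthonormal ℂ (fun i : s => u i) → Orthonormal ℂ (fun i : s => v i) →
        ∑ i ∈ s, ‖⟪u i, T (v i)⟫_ℂ‖ ≤ c) :
    ∑ i ∈ Finset.range (Module.finrank ℂ E), T.singularValues i ≤ c := by
  classical
  set hS := T.isSymmetric_adjoint_comp_self with hS'
  set e := hS.eigenvectorBasis rfl with he
  set σ : Fin (Module.finrank ℂ E) → ℝ := fun i => T.singularValues i with hσ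
  have hin : ∀ i j, ⟪T (e i), T (e j)⟫_ℂ = if i = j then ((σ i : ℂ)) ^ 2 else 0 := by
    intro i j
    have h1 : ⟪T (e i), T (e j)⟫_ℂ = ⟪e i, (LinearMap.adjoint T ∘ₗ T) (e j)⟫_ℂ := by
      rw [LinearMap.comp_apply, LinearMap.adjoint_inner_right]
    rw [h1, hS.apply_eigenvectorBasis rfl j, inner_smul_right,
      orthonormal_iff_ite.1 e.orthonormal i j, ← T.sq_singularValues_fin rfl j]
    split_ifs with hij
    · subst hij
      simp [hσ]
    · simp
  set s : Finset (Fin (Module.finrank ℂ E)) := Finset.univ.filter fun i => σ i ≠ 0 with hs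
  have hσ0 : ∀ i ∈ s, (σ i : ℂ) ≠ 0 := fun i hi =>
    Complex.ofReal_ne_zero.2 (Finset.mem_filter.1 hi).2
  have hu : Orthonormal ℂ fun i : s => (σ i : ℂ)⁻¹ • T (e i) := by
    rw [orthonormal_iff_ite]
    intro i j
    rw [inner_smul_left, inner_smul_right, hin]
    by_cases hij : i = j
    · subst hij
      have := hσ0 i i.2
      simp
      field_simp
    · rw [if_neg fun h => hij (Subtype.ext h), if_neg hij]
      simp
  have hv : Orthonormal ℂ fun i : s => e i := e.orthonormal.comp _ Subtype.val_injective
  have hle := h s (fun i => (σ i : ℂ)⁻¹ • T (e i)) e hu hv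
  refine le_trans (le_of_eq ?_) hle
  rw [Finset.sum_range (fun i => T.singularValues i)]
  change ∑ i, σ i = _
  rw [hs, Finset.sum_filter]
  refine Finset.sum_congr rfl fun i _ => ?_
  split_ifs with hi
  · rw [inner_smul_left, hin, if_pos rfl]
    have h0 : 0 ≤ σ i := T.singularValues_nonneg i
    simp only [norm_mul, norm_pow, RCLike.norm_conj, norm_inv, Complex.norm_real,
      Real.norm_of_nonneg h0]
    field_simp
  · exact not_not.1 hi

-- Write `P = Bᴴ B`. Each term is `|⟨B u, B v⟩| ≤ (‖B u‖² + ‖B v‖²) / 2`, and Bessel's inequality on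
-- the rows of `B` bounds each sum of squares by `tr P`.
open scoped InnerProductSpace MatrixOrder in
theorem sum_norm_inner_posSemidef_le {ι κ : Type*} [Fintype ι] [DecidableEq ι] {P : Matrix ι ι ℂ}
    (hP : P.PosSemidef) (s : Finset κ) {u v : κ → EuclideanSpace ℂ ι}
    (hu : Orthonormal ℂ fun i : s => u i) (hv : Orthonormal ℂ fun i : s => v i) :
    ∑ i ∈ s, ‖⟪u i, Matrix.toEuclideanLin P (v i)⟫_ℂ‖ ≤ P.trace.re := by
  obtain ⟨B, rfl⟩ : ∃ B : Matrix ι ι ℂ, P = Bᴴ * B :=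
    CStarAlgebra.nonneg_iff_eq_star_mul_self.1 hP.nonneg
  set b : ι → EuclideanSpace ℂ ι := fun a => WithLp.toLp 2 (star (B a)) with hb
  have hBv : ∀ (w : EuclideanSpace ℂ ι) a, (B *ᵥ w.ofLp) a = ⟪b a, w⟫_ℂ := by
    intro w a
    simp [hb, Matrix.mulVec, EuclideanSpace.inner_eq_star_dotProduct, dotProduct_comm]
  have hbess : ∀ w : κ → EuclideanSpace ℂ ι, (Orthonormal ℂ fun i : s => w i) →
      ∑ i ∈ s, ∑ a, ‖⟪b a, w i⟫_ℂ‖ ^ 2 ≤ (Bᴴ * B).trace.re := by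
    intro w hw
    rw [Finset.sum_comm]
    have ht : (Bᴴ * B).trace.re = ∑ a, ‖b a‖ ^ 2 := by
      rw [Matrix.trace_mul_comm, Matrix.trace, Complex.re_sum]
      refine Finset.sum_congr rfl fun a _ => ?_
      rw [EuclideanSpace.norm_sq_eq, Matrix.diag_apply, Matrix.mul_apply, Complex.re_sum]
      refine Finset.sum_congr rfl fun c _ => ?_
      simp [hb, Complex.mul_conj, Complex.normSq_eq_norm_sq, -Complex.ofReal_pow]
    rw [ht]
    refine Finset.sum_le_sum fun a _ => ?_
    have := hw.sum_inner_products_le (b a) (s := Finset.univ)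
    rw [Finset.sum_coe_sort s fun i => ‖⟪w i, b a⟫_ℂ‖ ^ 2] at this
    simpa only [norm_inner_symm (b a)] using this
  have hterm : ∀ i ∈ s, ‖⟪u i, Matrix.toEuclideanLin (Bᴴ * B) (v i)⟫_ℂ‖ ≤
      (∑ a, ‖⟪b a, u i⟫_ℂ‖ ^ 2 + ∑ a, ‖⟪b a, v i⟫_ℂ‖ ^ 2) / 2 := by
    intro i _
    have : ⟪u i, Matrix.toEuclideanLin (Bᴴ * B) (v i)⟫_ℂ =
        ∑ a, star ⟪b a, u i⟫_ℂ * ⟪b a, v i⟫_ℂ := by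
      simp only [← hBv]
      change _ = star (B *ᵥ (u i).ofLp) ⬝ᵥ (B *ᵥ (v i).ofLp)
      rw [Matrix.star_mulVec, ← Matrix.dotProduct_mulVec, Matrix.mulVec_mulVec,
        EuclideanSpace.inner_eq_star_dotProduct, dotProduct_comm]
      rfl
    rw [this, ← Finset.sum_add_distrib, Finset.sum_div]
    refine (norm_sum_le _ _).trans (Finset.sum_le_sum fun a _ => ?_)
    rw [norm_mul, norm_star]
    nlinarith [sq_nonneg (‖⟪b a, u i⟫_ℂ‖ - ‖⟪b a, v i⟫_ℂ‖)]
  refine (Finset.sum_le_sum hterm).trans ?_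
  rw [← Finset.sum_div, Finset.sum_add_distrib]
  linarith [hbess u hu, hbess v hv]

theorem traceNorm_sub_le_of_posSemidef {ι : Type*} [Fintype ι] [DecidableEq ι] {P Q : Matrix ι ι ℂ}
    (hP : P.PosSemidef) (hQ : Q.PosSemidef) : traceNorm (P - Q) ≤ P.trace.re + Q.trace.re := by
  have hcard : Fintype.card ι = Module.finrank ℂ (EuclideanSpace ℂ ι) := finrank_euclideanSpace.symm
  rw [traceNorm, hcard]
  refine sum_singularValues_le_of_forall_inner_le _ fun s u v hu hv => ?_
  refine le_trans (Finset.sum_le_sum fun i _ => ?_) (Finset.sum_add_distrib.trans_le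
    (add_le_add (sum_norm_inner_posSemidef_le hP s hu hv)
      (sum_norm_inner_posSemidef_le hQ s hu hv)))
  rw [map_sub, LinearMap.sub_apply, inner_sub_right]
  exact norm_sub_le _ _

/-- The polynomial `x ↦ ⟨w, x^{⊗N}⟩`. -/
def tensorPoly {N : ℕ} (w : (Fin N → Fin d) → ℂ) : MvPolynomial (Fin d) ℂ :=
  ∑ a, MvPolynomial.C (star (w a)) * ∏ i, MvPolynomial.X (a i)

theorem isHomogeneous_tensorPoly {N : ℕ} (w : (Fin N → Fin d) → ℂ) :
    (tensorPoly w).IsHomogeneous N := by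
  refine MvPolynomial.IsHomogeneous.sum _ _ _ fun a _ => ?_
  simpa using (MvPolynomial.isHomogeneous_C (Fin d) (star (w a))).mul
    (MvPolynomial.IsHomogeneous.prod Finset.univ (fun i => MvPolynomial.X (a i)) (fun _ => 1)
      fun i _ => MvPolynomial.isHomogeneous_X ℂ (a i))

theorem continuous_momentIntegrand {N : ℕ} (a b : Fin N → Fin d) :
    Continuous fun ψ : EuclideanSpace ℂ (Fin d) => ∏ i, (ψ (a i) * star (ψ (b i))) := by
  fun_prop

/-- This turns inequalities between means of `|f|²` into operator inequalities between moments. -/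
theorem star_dotProduct_moment_mulVec {N : ℕ} {μ : Measure (EuclideanSpace ℂ (Fin d))}
    (hμ : ∀ F : EuclideanSpace ℂ (Fin d) → ℂ, Continuous F → Integrable F μ)
    (w : (Fin N → Fin d) → ℂ) :
    star w ⬝ᵥ (moment N μ *ᵥ w) =
      ((∫ ψ, ‖MvPolynomial.eval ψ.ofLp (tensorPoly w)‖ ^ 2 ∂μ : ℝ) : ℂ) := by
  have e : ∀ ψ : EuclideanSpace ℂ (Fin d),
      ((‖MvPolynomial.eval ψ.ofLp (tensorPoly w)‖ ^ 2 : ℝ) : ℂ) =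
        ∑ a, ∑ b, star (w a) * (∏ i, (ψ (a i) * star (ψ (b i)))) * w b := by
    intro ψ
    rw [Complex.ofReal_pow, ← Complex.mul_conj', ← Complex.star_def]
    simp only [tensorPoly, map_sum, map_mul, map_prod, MvPolynomial.eval_C, MvPolynomial.eval_X,
      star_sum, Finset.sum_mul_sum, star_mul', star_star, star_prod, Finset.prod_mul_distrib]
    refine Finset.sum_congr rfl fun a _ => Finset.sum_congr rfl fun b _ => ?_
    ring
  have hi : ∀ a b : Fin N → Fin d, Integrable (fun ψ : EuclideanSpace ℂ (Fin d) =>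
      star (w a) * (∏ i, (ψ (a i) * star (ψ (b i)))) * w b) μ :=
    fun a b => ((hμ _ (continuous_momentIntegrand a b)).const_mul _).mul_const _
  rw [← integral_complex_ofReal]
  simp only [e]
  rw [integral_finsetSum _ fun a _ => integrable_finsetSum _ fun b _ => hi a b]
  simp only [dotProduct, Matrix.mulVec, Pi.star_apply, moment, Matrix.of_apply, Finset.mul_sum]
  refine Finset.sum_congr rfl fun a _ => ?_
  rw [integral_finsetSum _ fun b _ => hi a b]
  refine Finset.sum_congr rfl fun b _ => ?_
  rw [integral_mul_const, integral_const_mul, mul_assoc]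

theorem isHermitian_moment {N : ℕ} (μ : Measure (EuclideanSpace ℂ (Fin d))) :
    (moment N μ).IsHermitian := by
  ext a b
  simp only [moment, Matrix.conjTranspose_apply, Matrix.of_apply, Complex.star_def]
  rw [← integral_conj]
  refine integral_congr_ae (.of_forall fun ψ => ?_)
  simp only [map_prod, map_mul, Complex.conj_conj]
  exact Finset.prod_congr rfl fun i _ => mul_comm _ _

theorem trace_moment {N : ℕ} {μ : Measure (EuclideanSpace ℂ (Fin d))} [IsProbabilityMeasure μ]
    (hμ : ∀ F : EuclideanSpace ℂ (Fin d) → ℂ, Continuous F → Integrable F μ)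
    (h1 : ∀ᵐ ψ ∂μ, ‖ψ‖ = 1) : (moment N μ).trace = 1 := by
  simp only [Matrix.trace, Matrix.diag_apply, moment, Matrix.of_apply]
  rw [← integral_finsetSum _ fun a _ => hμ _ (continuous_momentIntegrand a a),
    integral_congr_ae (g := fun _ => (1 : ℂ))]
  · simp
  · filter_upwards [h1] with ψ hψ
    have : ∑ c, ψ c * star (ψ c) = 1 := by
      simp only [Complex.star_def, Complex.mul_conj']
      have := EuclideanSpace.norm_sq_eq ψ
      rw [hψ] at this
      exact_mod_cast this.symm.trans (by norm_num)
    rw [← Fintype.prod_sum (fun (_ : Fin N) c => ψ c * star (ψ c))]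
    simp only [this, Finset.prod_const_one]

theorem posSemidef_moment_realHaar_sub [NeZero d] (N : ℕ) :
    (moment N (realHaar d) - (haarRatio d N : ℂ) • moment N (complexHaar d)).PosSemidef := by
  have hH : (moment N (realHaar d) -
      (haarRatio d N : ℂ) • moment N (complexHaar d)).IsHermitian := by
    refine (isHermitian_moment _).sub ?_
    rw [Matrix.IsHermitian, Matrix.conjTranspose_smul, (isHermitian_moment _).eq,
      Complex.star_def, Complex.conj_ofReal]
  refine Matrix.PosSemidef.of_dotProduct_mulVec_nonneg hH fun w => ?_
  rw [Matrix.sub_mulVec, Matrix.smul_mulVec, dotProduct_sub, dotProduct_smul,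
    star_dotProduct_moment_mulVec fun F => integrable_realHaar,
    star_dotProduct_moment_mulVec fun F => integrable_complexHaar, smul_eq_mul,
    ← Complex.ofReal_mul, ← Complex.ofReal_sub]
  exact Complex.zero_le_real.2
    (sub_nonneg.2 (haarRatio_mul_integral_normSq_eval_le (isHomogeneous_tensorPoly w)))

theorem posSemidef_moment_complexHaar [NeZero d] (N : ℕ) :
    (moment N (complexHaar d)).PosSemidef := by
  refine Matrix.PosSemidef.of_dotProduct_mulVec_nonneg (isHermitian_moment _) fun w => ?_
  rw [star_dotProduct_moment_mulVec fun F => integrable_complexHaar]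
  exact Complex.zero_le_real.2 (integral_nonneg fun _ => by positivity)

/-- The difference is `(1 - α) M_ℂ - (M_ℝ - α M_ℂ)`, where both terms are positive of trace `1 - α`.
-/
theorem traceNorm_moment_sub_le [NeZero d] (N : ℕ) :
    traceNorm (moment N (complexHaar d) - moment N (realHaar d)) ≤ (N : ℝ) ^ 2 / d := by
  set α := haarRatio d N with hα
  have e : moment N (complexHaar d) - moment N (realHaar d) =
      ((1 - α : ℝ) : ℂ) • moment N (complexHaar d) -
        (moment N (realHaar d) - (α : ℂ) • moment N (complexHaar d)) := by
    rw [Complex.ofReal_sub, Complex.ofReal_one, sub_smul, one_smul]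
    abel
  have hα1 : 0 ≤ 1 - α := sub_nonneg.2 (haarRatio_le_one d N)
  have h := traceNorm_sub_le_of_posSemidef
    ((posSemidef_moment_complexHaar (d := d) N).smul (Complex.zero_le_real.2 hα1))
    (posSemidef_moment_realHaar_sub (d := d) N)
  rw [← hα, ← e, Matrix.trace_sub, Matrix.trace_smul, Matrix.trace_smul,
    trace_moment (fun F => integrable_complexHaar) ae_complexHaar_norm_eq_one,
    trace_moment (fun F => integrable_realHaar) ae_realHaar_norm_eq_one] at h
  have h2 := one_sub_haarRatio_le (d := d) N
  refine h.trans ?_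
  have h3 : (N : ℝ) ^ 2 / d = 2 * ((N : ℝ) ^ 2 / (2 * d)) := by
    have : (d : ℝ) ≠ 0 := by exact_mod_cast NeZero.ne d
    field_simp
  rw [h3]
  simp
  linarith

end RealVectorSearch

end

theorem theorem1 :
    (∃ c : ℝ, 0 < c ∧ ∀ C : ℕ, 2 ≤ C → ∀ (n : ℕ) (A : RealVectorSearch.QAlg n C 1),
      9 / 10 ≤ A.successProb →
        (∃ i : Fin C, c * (2 : ℝ) ^ ((n : ℝ) / 2) ≤ (A.copies i : ℝ)) ∧
          c * (2 : ℝ) ^ ((n : ℝ) / 2) ≤ (A.time : ℝ)) ∧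
    ∀ n N : ℕ,
      RealVectorSearch.traceNorm
        (RealVectorSearch.moment N (RealVectorSearch.complexHaar (2 ^ n)) -
          RealVectorSearch.moment N (RealVectorSearch.realHaar (2 ^ n))) ≤
        4 * (N : ℝ) ^ 2 / (2 : ℝ) ^ n := by
  -- Since `8/5 ≥ 1`, the constant `c = 1` works; the index is one whose state is copied most often.
  refine ⟨⟨1, one_pos, fun C hC n A hA => ?_⟩, fun n N => ?_⟩
  · have : Nonempty (Fin C) := ⟨⟨0, by omega⟩⟩
    obtain ⟨i, hi⟩ := Finite.exists_max fun i : Fin C => A.copies i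
    have h := RealVectorSearch.QAlg.two_rpow_le_of_successProb hC hA hi
    rw [one_mul]
    exact ⟨⟨i, h⟩, h.trans (by exact_mod_cast RealVectorSearch.QAlg.copies_le_time i A)⟩
  · refine (RealVectorSearch.traceNorm_moment_sub_le N).trans ?_
    push_cast
    gcongr
    linarith [sq_nonneg (N : ℝ)]
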